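/- Let $f\colon X\to S$ be a finite and flat morphism of algebraic spaces with $S$ locally Noetherian. Then $f$ is finite locally free, i.e. for every scheme $T$ and every morphism $T\to S$, the base change $X\times_S T\to T$ is an affine morphism of schemes along which the direct image of the structure sheaf of $X\times_S T$ is locally on $T$ a free $\mathcal{O}_T$-module of finite rank. In particular, if the image of $f$ meets every nonempty open and closed subspace of $S$ (equivalently, every connected component of $S$; for instance, if $S$ is connected and $X$ is nonempty), then $f$ is faithfully flat, i.e. flat and surjective. -/

import Mathlib

open CategoryTheory AlgebraicGeometry

universe u

namespace AlgebraicSpace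

/-- An algebraic space: a sheaf on the big étale site of schemes, whose diagonal is representable
by schemes, and which admits an étale surjection from a scheme. Morphisms of algebraic spaces are
the morphisms of the underlying presheaves. An algebraic space over a base `B` is such an `F`
together with a morphism `F ⟶ B`, so no base is fixed here.

For a property `P` of morphisms of schemes, `MorphismProperty.presheaf P f` is the usual notion for
representable morphisms: every base change of `f` to a scheme is a scheme and has property `P`. -/
structure IsAlgebraicSpace (F : Scheme.{u}ᵒᵖ ⥤ Type u) : Prop where
  isSheaf : Presheaf.IsSheaf Scheme.etaleTopology F
  diag_representable : yoneda.relativelyRepresentable (Limits.diag F)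
  exists_atlas : ∃ (U : Scheme.{u}) (p : yoneda.obj U ⟶ F),
    MorphismProperty.presheaf (@Etale ⊓ @Surjective) p

/-- An algebraic space is locally Noetherian if it admits an étale surjection from a locally
Noetherian scheme. -/
def LocallyNoetherian (F : Scheme.{u}ᵒᵖ ⥤ Type u) : Prop :=
  ∃ (U : Scheme.{u}) (p : yoneda.obj U ⟶ F),
    MorphismProperty.presheaf (@Etale ⊓ @Surjective) p ∧ IsLocallyNoetherian U

variable {X S : Scheme.{u}ᵒᵖ ⥤ Type u}

/-- A morphism of algebraic spaces is finite if it is representable and all its base changes to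
schemes are finite morphisms of schemes. -/
def IsFiniteMor (f : X ⟶ S) : Prop :=
  MorphismProperty.presheaf @IsFinite f

/-- A morphism of algebraic spaces (not necessarily representable) is flat if it is flat étale
locally on source and target: for every commutative square formed by `f`, étale morphisms `U ⟶ X`
and `V ⟶ S` from schemes, and a morphism `h : U ⟶ V`, the morphism of schemes `h` is flat. -/
def IsFlat (f : X ⟶ S) : Prop :=
  ∀ ⦃U V : Scheme.{u}⦄ (q : yoneda.obj U ⟶ X) (p : yoneda.obj V ⟶ S) (h : U ⟶ V),
    MorphismProperty.presheaf @Etale q → MorphismProperty.presheaf @Etale p →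
      q ≫ f = yoneda.map h ≫ p → Flat h

/-- A morphism of schemes `f : Y ⟶ T` is finite locally free if it is affine and `f_* 𝒪_Y` is,
locally on `T`, a free `𝒪_T`-module of finite rank. -/
def SchemeFiniteLocallyFree : MorphismProperty Scheme.{u} := fun Y T f ↦
  IsAffineHom f ∧ ∀ t : T, ∃ V : T.Opens, t ∈ V ∧ IsAffineOpen V ∧
    letI := (f.app V).hom.toAlgebra
    Module.Finite Γ(T, V) Γ(Y, f ⁻¹ᵁ V) ∧ Module.Free Γ(T, V) Γ(Y, f ⁻¹ᵁ V)

/-- A morphism of algebraic spaces is finite locally free if it is representable and all its base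
changes to schemes are finite locally free morphisms of schemes. -/
def IsFiniteLocallyFree (f : X ⟶ S) : Prop :=
  MorphismProperty.presheaf SchemeFiniteLocallyFree f

/-- A point of `F` with values in a field `K`. -/
abbrev FieldPoint (K : Type u) [Field K] (F : Scheme.{u}ᵒᵖ ⥤ Type u) : Type (u + 1) :=
  yoneda.obj (Spec (CommRingCat.of K)) ⟶ F

/-- A morphism of algebraic spaces is surjective if it is so on points (equivalence classes of
field-valued points): every `K`-valued point of the target lifts to an `L`-valued point of the
source, for some field extension `L` of `K`. -/
def IsSurjective (f : X ⟶ S) : Prop :=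
  ∀ (K : Type u) [Field K] (s : FieldPoint K S),
    ∃ (L : Type u) (_ : Field L) (φ : K →+* L) (x : FieldPoint L X),
      x ≫ f = yoneda.map (Spec.map (CommRingCat.ofHom φ)) ≫ s

/-- Faithfully flat: flat and surjective. -/
def IsFaithfullyFlat (f : X ⟶ S) : Prop :=
  IsFlat f ∧ IsSurjective f

/-- An algebraic space is nonempty if it has a field-valued point. -/
def IsNonempty (F : Scheme.{u}ᵒᵖ ⥤ Type u) : Prop :=
  ∃ (K : Type u) (_ : Field K), Nonempty (FieldPoint K F)

/-- The image of `f : X ⟶ S` meets every nonempty open and closed subspace `j : W ⟶ S`: some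
field-valued point of `W` and some field-valued point of `X` have the same image in `S`. If `S` is
connected, this just says that `X` is nonempty or `S` is empty. For `S` locally Noetherian, it says
that the image of `f` meets every connected component of `S`. -/
def MeetsEveryClopen (f : X ⟶ S) : Prop :=
  ∀ ⦃W : Scheme.{u}ᵒᵖ ⥤ Type u⦄ (j : W ⟶ S),
    MorphismProperty.presheaf (@IsOpenImmersion ⊓ @IsClosedImmersion) j → IsNonempty W →
      ∃ (K : Type u) (_ : Field K) (x : FieldPoint K X) (w : FieldPoint K W), x ≫ f = w ≫ j

end AlgebraicSpace

/-!
Let `p : U ⟶ S` be an étale surjection from a locally Noetherian scheme. The base change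
`X ×_S U ⟶ U` is finite, it is flat because its source is étale over `X`, and it is locally of
finite presentation because `U` is locally Noetherian. For a scheme `T` over `S`, the base change
of `f` to `U ×_S T` is also a base change of `X ×_S U ⟶ U`, so it has the same properties. Flatness
and local finite presentation descend along the étale surjection `U ×_S T ⟶ T`, so that
`X ×_S T ⟶ T` is finite, flat and locally of finite presentation
(`flat_and_locallyOfFinitePresentation_snd`). A finite flat algebra of finite presentation is a
finitely presented flat module, hence free locally on the base; this gives
`schemeFiniteLocallyFree_of_flat`.

In particular `X ×_S T ⟶ T` is open and closed, and its image is a clopen subset of `T`. The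
complements of these images fit together to a subfunctor `imageCompl f` of `S`, whose inclusion is
representable by open and closed immersions (`presheaf_imageCompl_ι`). No point of it has the same
image in `S` as a point of `X`. If the image of `f` meets every nonempty open and closed subspace,
then `imageCompl f` has no field-valued points, which means that every field-valued point of `S`
has a nonempty fibre (`isSurjective_of_meetsEveryClopen`).
-/

namespace AlgebraicSpace

open Limits Opposite

/-- Flatness of ring homomorphisms descends along faithfully flat base change. -/
lemma flat_codescendsAlong_faithfullyFlat :
    RingHom.CodescendsAlong RingHom.Flat RingHom.FaithfullyFlat := by
  refine RingHom.CodescendsAlong.mk _ RingHom.Flat.respectsIso fun R S T _ _ _ _ _ hS hT ↦ ?_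
  rw [RingHom.faithfullyFlat_algebraMap_iff] at hS
  rw [RingHom.flat_algebraMap_iff] at hT ⊢
  exact .of_flat_tensorProduct R T S

/-- A property of morphisms of schemes that is given by a property of ring homomorphisms descends
along étale covers as soon as the latter descends along faithfully flat ring homomorphisms. -/
lemma of_isPullback_of_etale_of_surjective {P : MorphismProperty Scheme.{u}}
    {Q : ∀ {R S : Type u} [CommRing R] [CommRing S], (R →+* S) → Prop} [HasRingHomProperty P Q]
    [P.IsStableUnderBaseChange] (hQ : RingHom.CodescendsAlong Q RingHom.FaithfullyFlat)
    {Y' T' Y T : Scheme.{u}} {c' : Y' ⟶ Y} {g' : Y' ⟶ T'} {g : Y ⟶ T} {c : T' ⟶ T} [Etale c]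
    [Surjective c] (h : IsPullback c' g' g c) (hg' : P g') : P g := by
  have := HasRingHomProperty.descendsAlong_flat (P := P) hQ
  exact MorphismProperty.of_isPullback_of_descendsAlong
    (Q := @Surjective ⊓ @Flat ⊓ @LocallyOfFinitePresentation) h.flip
    ⟨⟨inferInstance, inferInstance⟩, inferInstance⟩ hg'

/-- A flat algebra that is finitely presented as a module becomes free after inverting an element
outside a given prime. The localizations are characterized by their universal properties, so that
rings of sections over basic open subsets can be used for them. -/
lemma exists_free_away {A B : Type u} [CommRing A] [CommRing B] [Algebra A B]
    [Module.FinitePresentation A B] [Module.Flat A B] (p : Ideal A) [p.IsPrime] :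
    ∃ r ∉ p, ∀ (A' B' : Type u) [CommRing A'] [CommRing B'] [Algebra A A'] [Algebra B B']
      [Algebra A' B'] [Algebra A B'] [IsScalarTower A A' B'] [IsScalarTower A B B']
      [IsLocalization.Away r A'] [IsLocalization.Away (algebraMap A B r) B'],
      Module.Free A' B' := by
  have : Module.Free (Localization.AtPrime p) (LocalizedModule p.primeCompl B) :=
    Module.free_of_flat_of_isLocalRing
  obtain ⟨r, hr, hfree, -⟩ := Module.FinitePresentation.exists_free_localizedModule_powers
    p.primeCompl (LocalizedModule.mkLinearMap p.primeCompl B) (Localization.AtPrime p)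
  refine ⟨r, hr, fun A' B' ↦ ?_⟩
  intros
  have : IsLocalization (Algebra.algebraMapSubmonoid B (.powers r)) B' := by
    rw [Algebra.algebraMapSubmonoid_powers]; infer_instance
  -- `B'` and `B_r` are the base changes of `B` to `A'` and `A_r`, so `B'` is the base change of the
  -- free module `B_r` along the isomorphism `A_r ≃ A'`.
  have h₁ := (isLocalizedModule_iff_isBaseChange (.powers r) A'
    (IsScalarTower.toAlgHom A B B').toLinearMap).mp inferInstance
  have h₂ := (isLocalizedModule_iff_isBaseChange (.powers r) (Localization (.powers r))
    (LocalizedModule.mkLinearMap (.powers r) B)).mp inferInstance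
  let e : Localization (.powers r) ≃ₐ[A] A' := IsLocalization.algEquiv (.powers r) _ _
  let : Algebra (Localization (.powers r)) A' := e.toRingHom.toAlgebra
  have : IsScalarTower A (Localization (.powers r)) A' :=
    .of_algebraMap_eq fun x ↦ (e.commutes x).symm
  exact .of_equiv (TensorProduct.AlgebraTensorModule.congr (.refl A' A') h₂.equiv.symm ≪≫ₗ
    TensorProduct.AlgebraTensorModule.cancelBaseChange A (Localization (.powers r)) A' A' B ≪≫ₗ
    h₁.equiv)

/-- A finite flat morphism of schemes that is locally of finite presentation is finite locally
free. -/
lemma schemeFiniteLocallyFree_of_flat {Y T : Scheme.{u}} (f : Y ⟶ T) [IsFinite f] [Flat f]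
    [LocallyOfFinitePresentation f] : SchemeFiniteLocallyFree f := by
  refine ⟨inferInstance, fun t ↦ ?_⟩
  obtain ⟨V, hV, htV, -⟩ := exists_isAffineOpen_mem_and_subset (x := t) (U := ⊤) trivial
  have hfV : IsAffineOpen (f ⁻¹ᵁ V) := hV.preimage f
  have h_fin := f.finite_app V hV
  have h_flat := f.flat_appLE hV hfV le_rfl
  have h_fp := f.finitePresentation_appLE hV hfV le_rfl
  rw [← Scheme.Hom.app_eq_appLE] at h_flat h_fp
  algebraize [(f.app V).hom]
  have := Module.FinitePresentation.of_finite_of_finitePresentation Γ(T, V) Γ(Y, f ⁻¹ᵁ V)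
  obtain ⟨r, hr, hfree⟩ := exists_free_away (A := Γ(T, V)) (B := Γ(Y, f ⁻¹ᵁ V))
    (hV.primeIdealOf ⟨t, htV⟩).asIdeal
  have hle : T.basicOpen r ≤ V := T.basicOpen_le r
  refine ⟨T.basicOpen r, ?_, hV.basicOpen r, f.finite_app _ (hV.basicOpen r), ?_⟩
  · change (⟨t, htV⟩ : V).1 ∈ T.basicOpen r
    rw [← hV.fromSpec_primeIdealOf ⟨t, htV⟩]
    change _ ∈ hV.fromSpec ⁻¹ᵁ T.basicOpen r
    rw [hV.fromSpec_preimage_basicOpen]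
    exact hr
  · let : Algebra Γ(T, V) Γ(T, T.basicOpen r) := (T.presheaf.map (homOfLE hle).op).hom.toAlgebra
    -- `Γ(T, D(r))` and `Γ(Y, f⁻¹ D(r))` are the localizations of `Γ(T, V)` and `Γ(Y, f⁻¹ V)` at
    -- `r`, with all the algebra structures induced by restriction and by `f`.
    have hle' : f ⁻¹ᵁ T.basicOpen r ≤ f ⁻¹ᵁ V := f.preimage_mono hle
    let : Algebra Γ(Y, f ⁻¹ᵁ V) Γ(Y, f ⁻¹ᵁ T.basicOpen r) :=
      (Y.presheaf.map (homOfLE hle').op).hom.toAlgebra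
    let : Algebra Γ(T, T.basicOpen r) Γ(Y, f ⁻¹ᵁ T.basicOpen r) :=
      (f.app (T.basicOpen r)).hom.toAlgebra
    let : Algebra Γ(T, V) Γ(Y, f ⁻¹ᵁ T.basicOpen r) :=
      (T.presheaf.map (homOfLE hle).op ≫ f.app (T.basicOpen r)).hom.toAlgebra
    have : IsScalarTower Γ(T, V) Γ(T, T.basicOpen r) Γ(Y, f ⁻¹ᵁ T.basicOpen r) :=
      .of_algebraMap_eq fun _ ↦ rfl
    have : IsScalarTower Γ(T, V) Γ(Y, f ⁻¹ᵁ V) Γ(Y, f ⁻¹ᵁ T.basicOpen r) :=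
      .of_algebraMap_eq fun x ↦ congr($(f.naturality (homOfLE hle).op).hom x)
    have : IsLocalization.Away r Γ(T, T.basicOpen r) :=
      hV.isLocalization_of_eq_basicOpen r (homOfLE hle) rfl
    have : IsLocalization.Away (algebraMap Γ(T, V) Γ(Y, f ⁻¹ᵁ V) r) Γ(Y, f ⁻¹ᵁ T.basicOpen r) :=
      hfV.isLocalization_of_eq_basicOpen _ (homOfLE hle') (Scheme.preimage_basicOpen f r)
    exact hfree _ _

/-- The subfunctor of `S` of those sections `T ⟶ S` whose image misses that of `f`, in the sense
that `X ×_S T` receives maps from the empty scheme only. -/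
def imageCompl {X S : Scheme.{u}ᵒᵖ ⥤ Type u} (f : X ⟶ S) : Subfunctor S where
  obj T := { s | ∀ (T' : Scheme.{u}) (b : T' ⟶ T.unop) (x : yoneda.obj T' ⟶ X),
    x ≫ f = yoneda.map b ≫ yonedaEquiv.symm s → IsEmpty T' }
  map a s hs T' b x hx := by
    refine hs T' (b ≫ a.unop) x ?_
    rw [hx, yonedaEquiv_symm_map, Functor.map_comp, Category.assoc]

section

variable {X S : Scheme.{u}ᵒᵖ ⥤ Type u} {f : X ⟶ S}

lemma yonedaEquiv_mem_imageCompl_iff (hf : yoneda.relativelyRepresentable f) {T : Scheme.{u}}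
    (t : yoneda.obj T ⟶ S) :
    yonedaEquiv t ∈ (imageCompl f).obj (op T) ↔ IsEmpty (hf.pullback t) := by
  refine ⟨fun h ↦ h _ (hf.snd t) (hf.fst t) (by simpa using hf.w t), fun h T' b x hx ↦ ?_⟩
  rw [Equiv.symm_apply_apply] at hx
  exact Function.isEmpty (hf.lift x b hx)

/-- Over a scheme `T`, the subfunctor `imageCompl f` consists of the morphisms to `T` that avoid the
image of `X ×_S T ⟶ T`. -/
lemma yonedaEquiv_map_comp_mem_imageCompl_iff (hf : yoneda.relativelyRepresentable f)
    {T T' : Scheme.{u}} (t : yoneda.obj T ⟶ S) (b : T' ⟶ T) :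
    yonedaEquiv (yoneda.map b ≫ t) ∈ (imageCompl f).obj (op T') ↔
      Set.range b ⊆ (Set.range (hf.snd t))ᶜ := by
  rw [Set.subset_compl_iff_disjoint_right, disjoint_comm, ← Scheme.isEmpty_pullback_iff]
  refine ⟨fun h ↦ h _ (pullback.snd _ _) (yoneda.map (pullback.fst _ _) ≫ hf.fst t) ?_,
    fun h T'' c x hx ↦ ?_⟩
  · rw [Equiv.symm_apply_apply, Category.assoc, hf.w, ← Functor.map_comp_assoc,
      ← Functor.map_comp_assoc, pullback.condition]
  · rw [Equiv.symm_apply_apply, ← Functor.map_comp_assoc] at hx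
    exact Function.isEmpty
      (pullback.lift (f := hf.snd t) (g := b) (hf.lift x (c ≫ b) hx) c (by simp))

/-- If every base change of `f` to a scheme has open and closed image, the complement of its image
is an open and closed subspace. -/
lemma presheaf_imageCompl_ι (hf : yoneda.relativelyRepresentable f)
    (hclopen : ∀ ⦃T : Scheme.{u}⦄ (t : yoneda.obj T ⟶ S), IsClopen (Set.range (hf.snd t))) :
    MorphismProperty.presheaf (@IsOpenImmersion ⊓ @IsClosedImmersion) (imageCompl f).ι := by
  have : (@IsOpenImmersion ⊓ @IsClosedImmersion : MorphismProperty Scheme.{u}).RespectsIso :=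
    MorphismProperty.RespectsIso.inf _ _
  refine MorphismProperty.relative.of_exists fun T t ↦ ?_
  let V : T.Opens := ⟨(Set.range (hf.snd t))ᶜ, (hclopen t).compl.isOpen⟩
  have hmem : yonedaEquiv (yoneda.map V.ι ≫ t) ∈ (imageCompl f).obj (op V) := by
    rw [yonedaEquiv_map_comp_mem_imageCompl_iff hf, Scheme.Opens.range_ι]
    exact subset_rfl
  let w : yoneda.obj V.toScheme ⟶ (imageCompl f).toFunctor := yonedaEquiv.symm ⟨_, hmem⟩
  have hw : w ≫ (imageCompl f).ι = yoneda.map V.ι ≫ t := by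
    exact (yonedaEquiv_symm_naturality_right _ (imageCompl f).ι _).trans
      (yonedaEquiv.symm_apply_apply _)
  refine ⟨V, w, V.ι, .of_forall_isPullback_app fun T' ↦ ?_, inferInstance,
    .of_isPreimmersion _ ?_⟩
  · refine (Types.isPullback_iff _ _ _ _).mpr ⟨congr($(hw).app T'), ?_, ?_⟩
    · rintro a b ⟨-, h⟩
      exact (cancel_mono V.ι).mp h
    · rintro ⟨s, hs⟩ (b : T'.unop ⟶ T) (h : s = t.app T' b)
      -- A pair of compatible sections is a morphism `b : T' ⟶ T` that avoids the image of `f`, so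
      -- it factors through the open subscheme `V`.
      have hb : Set.range b ⊆ Set.range V.ι := by
        rw [Scheme.Opens.range_ι]
        refine (yonedaEquiv_map_comp_mem_imageCompl_iff hf t b).mp ?_
        rw [← yonedaEquiv_naturality, map_yonedaEquiv]
        exact h ▸ hs
      have hfac := IsOpenImmersion.lift_fac V.ι b hb
      refine ⟨IsOpenImmersion.lift V.ι b hb, Subtype.ext ?_, hfac⟩
      refine Eq.trans congr($(hw).app T' (IsOpenImmersion.lift V.ι b hb)) (.trans ?_ h.symm)
      exact congr(t.app T' $hfac)
  · rw [Scheme.Opens.range_ι]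
    exact (hclopen t).compl.isClosed

/-- If `f` has open and closed image after every base change to a scheme and this image meets
every nonempty open and closed subspace, then `f` is surjective: otherwise the complement of the
image would be a nonempty open and closed subspace. -/
lemma isSurjective_of_meetsEveryClopen (hf : yoneda.relativelyRepresentable f)
    (hclopen : ∀ ⦃T : Scheme.{u}⦄ (t : yoneda.obj T ⟶ S), IsClopen (Set.range (hf.snd t)))
    (h : MeetsEveryClopen f) : IsSurjective f := by
  intro K _ s
  by_cases hs : IsEmpty (hf.pullback s)
  · -- `s` is a point of the complement of the image, so the image of `f` meets this complement.
    obtain ⟨L, _, x, w, hxw⟩ := h _ (presheaf_imageCompl_ι hf hclopen) ⟨K, inferInstance,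
      ⟨yonedaEquiv.symm ⟨_, (yonedaEquiv_mem_imageCompl_iff hf s).mpr hs⟩⟩⟩
    refine ((yonedaEquiv w).2 _ (𝟙 _) x ?_).elim (IsLocalRing.closedPoint L)
    refine hxw.trans ?_
    exact ((congr(yoneda.map (𝟙 _) ≫ $(yonedaEquiv.symm_apply_apply (w ≫ (imageCompl f).ι)))).trans
      (by simp)).symm
  · -- The residue field of any point of `X ×_S Spec K` is the required extension of `K`.
    obtain ⟨y⟩ := not_isEmpty_iff.mp hs
    let Y := hf.pullback s
    let g : Spec (Y.residueField y) ⟶ Spec (.of K) := Y.fromSpecResidueField y ≫ hf.snd s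
    obtain ⟨φ, hφ⟩ := Spec.map_surjective g
    refine ⟨Y.residueField y, inferInstance, φ.hom,
      yoneda.map (Y.fromSpecResidueField y) ≫ hf.fst s, ?_⟩
    change _ = yoneda.map (Spec.map φ) ≫ s
    rw [hφ, Category.assoc, hf.w, Functor.map_comp, Category.assoc]

/-- For `t₁ : T₁ ⟶ S` factoring through `t₂ : T₂ ⟶ S`, the base change of `f` to `T₁` is the base
change to `T₁` of its base change to `T₂`. -/
lemma isPullback_snd (hf : yoneda.relativelyRepresentable f) {T₁ T₂ : Scheme.{u}} (a : T₁ ⟶ T₂)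
    (t₂ : yoneda.obj T₂ ⟶ S) (t₁ : yoneda.obj T₁ ⟶ S) (h : t₁ = yoneda.map a ≫ t₂) :
    IsPullback (hf.lift (hf.fst t₁) (hf.snd t₁ ≫ a)
        (by rw [hf.w, h, Functor.map_comp, Category.assoc]))
      (hf.snd t₁) (hf.snd t₂) a := by
  refine .of_map yoneda (by simp) (.of_right ?_ (by simp [← Functor.map_comp]) (hf.isPullback t₂))
  rw [hf.lift_fst, ← h]
  exact hf.isPullback t₁

/-- Flatness and finite presentation of the base changes of `f` hold over a locally Noetherian
étale cover of `S`, and hence over every scheme over `S`, by étale descent. -/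
lemma flat_and_locallyOfFinitePresentation_snd (hN : LocallyNoetherian S) (hfin : IsFiniteMor f)
    (hflat : IsFlat f) {T : Scheme.{u}} (t : yoneda.obj T ⟶ S) :
    (@Flat ⊓ @LocallyOfFinitePresentation : MorphismProperty Scheme.{u}) (hfin.rep.snd t) := by
  -- `p : U ⟶ S` is a locally Noetherian atlas.
  obtain ⟨U, p, hp, hU⟩ := hN
  have hp_etale : MorphismProperty.presheaf @Etale p :=
    MorphismProperty.relative_monotone inf_le_left _ hp
  have := MorphismProperty.relative_isStableUnderBaseChange (F := yoneda) (@Etale.{u})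
  -- The base change of `f` to `U` is flat because its source is étale over `X`, and finite over a
  -- locally Noetherian scheme, hence of finite presentation.
  have hsq := hfin.rep.isPullback p
  have : IsFinite (hfin.rep.snd p) := hfin.property_snd p
  have hflatU : Flat (hfin.rep.snd p) :=
    hflat _ p _ (MorphismProperty.of_isPullback hsq.flip hp_etale) hp_etale hsq.w
  have hlfpU : LocallyOfFinitePresentation (hfin.rep.snd p) :=
    LocallyOfFinitePresentation.iff_locallyOfFiniteType.mpr inferInstance
  -- The base change of `f` to `U ×_S T` is a base change both of the one to `U` and of the one to
  -- `T`, and `U ×_S T ⟶ T` is étale and surjective.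
  let c : hp.rep.pullback t ⟶ T := hp.rep.snd t
  let d : hp.rep.pullback t ⟶ U := hp.rep.fst' t
  have hc : (@Etale ⊓ @Surjective : MorphismProperty Scheme.{u}) c := hp.property_snd t
  have hcd : yoneda.map d ≫ p = yoneda.map c ≫ t := by
    rw [hp.rep.map_fst', hp.rep.w]
  have := hc.1
  have := hc.2
  have hU' := isPullback_snd hfin.rep d p _ rfl
  have hT' := isPullback_snd hfin.rep c t _ hcd
  exact ⟨of_isPullback_of_etale_of_surjective flat_codescendsAlong_faithfullyFlat hT'
      (MorphismProperty.of_isPullback hU' hflatU),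
    of_isPullback_of_etale_of_surjective RingHom.FinitePresentation.codescendsAlong_faithfullyFlat
      hT' (MorphismProperty.of_isPullback hU' hlfpU)⟩

end

end AlgebraicSpace

theorem mainTheorem3 {X S : Scheme.{u}ᵒᵖ ⥤ Type u}
    (hX : AlgebraicSpace.IsAlgebraicSpace X) (hS : AlgebraicSpace.IsAlgebraicSpace S)
    (hN : AlgebraicSpace.LocallyNoetherian S) (f : X ⟶ S)
    (hfin : AlgebraicSpace.IsFiniteMor f) (hflat : AlgebraicSpace.IsFlat f) :
    AlgebraicSpace.IsFiniteLocallyFree f ∧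
      (AlgebraicSpace.MeetsEveryClopen f → AlgebraicSpace.IsFaithfullyFlat f) := by
  have hsnd {T : Scheme.{u}} (t : yoneda.obj T ⟶ S) :=
    AlgebraicSpace.flat_and_locallyOfFinitePresentation_snd hN hfin hflat t
  refine ⟨⟨hfin.rep, fun T Y t fst snd h ↦ ?_⟩, fun hmeets ↦
    ⟨hflat, AlgebraicSpace.isSurjective_of_meetsEveryClopen hfin.rep (fun T t ↦ ?_) hmeets⟩⟩
  · have : (@Flat ⊓ @LocallyOfFinitePresentation : MorphismProperty Scheme.{u}).RespectsIso :=
      @MorphismProperty.RespectsIso.inf _ _ _ _ Flat.isStableUnderBaseChange.respectsIso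
        locallyOfFinitePresentation_isStableUnderBaseChange.respectsIso
    obtain ⟨_, _⟩ := (MorphismProperty.relative_of_snd hfin.rep fun _ ↦ hsnd).property t fst snd h
    have : IsFinite snd := hfin.property t fst snd h
    exact AlgebraicSpace.schemeFiniteLocallyFree_of_flat snd
  · -- Finite morphisms are closed, flat morphisms locally of finite presentation are open.
    obtain ⟨_, _⟩ := hsnd t
    have : IsFinite (hfin.rep.snd t) := hfin.property_snd t
    exact ⟨(hfin.rep.snd t).isClosedMap.isClosed_range, (hfin.rep.snd t).isOpenMap.isOpen_range⟩
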